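/- Let $K$ be a perfect field of characteristic $p>0$, let $P_n=K[x_1,\ldots,x_n]$, and let $I=(f_1,\ldots,f_m)$ be a prime but not maximal ideal of $P_n$. Let $A=S^{-1}(P_n/I)$ be the localization of $P_n/I$ at a multiplicatively closed subset $S$ of $P_n/I$, and assume that $A$ is a domain; let $Q$ be its field of fractions. Let $\overline{J}=\left(\overline{\partial f_i/\partial x_j}\right)\in M_{m,n}(A)$ be the Jacobi matrix, where the bar denotes the image under the natural map $P_n\to A$, let $r$ be the rank of $\overline{J}$ over $Q$, and let $\mathfrak{a}_r$ be the Jacobian ideal of $A$, that is, the ideal of $A$ generated by all the $r\times r$ minors of $\overline{J}$ (for $r=0$ the only minor is $1$, so $\mathfrak{a}_0=A$). A higher (Hasse–Schmidt) derivation of $A$ over $K$ is a sequence $\delta=(\delta_0=\mathrm{id}_A,\delta_1,\delta_2,\ldots)$ of $K$-linear maps $A\to A$ such that $\delta_k(xy)=\sum_{i+j=k}\delta_i(x)\delta_j(y)$ for all $k\geq 0$ and $x,y\in A$. Then every higher derivation of $A$ leaves the Jacobian ideal invariant: for every higher derivation $\delta=(\delta_k)_{k\geq 0}$ of $A$ over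 $K$ and every $k\geq 0$, $\delta_k(\mathfrak{a}_r)\subseteq\mathfrak{a}_r$. -/

import Mathlib

/-- A higher (Hasse–Schmidt) derivation over `K` of a commutative `K`-algebra `A`: a sequence of
`K`-linear maps `δ₀ = id, δ₁, δ₂, …` with `δₖ(xy) = ∑_{i+j=k} δᵢ(x) δⱼ(y)`. -/
structure HigherDerivation (K A : Type*) [CommRing K] [CommRing A] [Algebra K A] where
  /-- The `k`-th component. -/
  map : ℕ → A →ₗ[K] A
  map_zero : map 0 = LinearMap.id
  map_mul : ∀ (k : ℕ) (x y : A),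
    map k (x * y) = ∑ ij ∈ Finset.HasAntidiagonal.antidiagonal k, map ij.1 x * map ij.2 y

/-- The ideal generated by all `s × s` minors of the matrix `M`. -/
def minorIdeal {A : Type*} [CommRing A] {m n : ℕ} (M : Matrix (Fin m) (Fin n) A) (s : ℕ) :
    Ideal A :=
  Ideal.span {d : A | ∃ (i : Fin s ↪o Fin m) (j : Fin s ↪o Fin n), d = (M.submatrix i j).det}

section Jacobian

variable {K : Type*} [Field K] {m n : ℕ} (f : Fin m → MvPolynomial (Fin n) K)
  (A : Type*) [CommRing A]
  [Algebra (MvPolynomial (Fin n) K ⧸ Ideal.span (Set.range f)) A]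

/-- The Jacobi matrix `(∂fᵢ/∂xⱼ)` with entries mapped to an algebra `A` over
`K[x₁, …, xₙ]/(f₁, …, fₘ)`. -/
noncomputable def jacobiMatrix : Matrix (Fin m) (Fin n) A :=
  Matrix.of fun i j =>
    algebraMap (MvPolynomial (Fin n) K ⧸ Ideal.span (Set.range f)) A
      (Ideal.Quotient.mk (Ideal.span (Set.range f)) (MvPolynomial.pderiv j (f i)))

/-- The rank of the Jacobi matrix over the field of fractions of the domain `A`. -/
noncomputable def jacobiRank [IsDomain A] : ℕ :=
  ((jacobiMatrix f A).map (algebraMap A (FractionRing A))).rank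

/-- The Jacobian ideal of the domain `A`: it is generated by the `r × r` minors of the Jacobi
matrix, where `r` is the rank of that matrix. -/
noncomputable def jacobianIdeal [IsDomain A] : Ideal A :=
  minorIdeal (jacobiMatrix f A) (jacobiRank f A)

end Jacobian

/-! A higher derivation is an algebra map φ : A → A[[t]], a ↦ ∑ δₖ(a)tᵏ. Write A = R/(f) with R a
localization of the polynomial ring, and lift the φ(xₛ) to series Yₛ over R with constant term xₛ.
Since fᵢ(Y) maps to φ(fᵢ) = 0, its coefficients lie in (f), so fᵢ(Y) = ∑ Nᵢₗ fₗ(x). Applying ∂/∂xⱼ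
coefficientwise and reducing to A[[t]] gives φ(J) M = N J, where M = (∂Yₛ/∂xⱼ) is the identity
modulo t, hence invertible. So φ(J) = N J M⁻¹, and the minors of φ(J) lie in the extension to A[[t]]
of the ideal of minors of J; reading off coefficients gives the invariance, for minors of any size.
-/

section MinorIdeal

variable {A B : Type*} [CommRing A] [CommRing B] {m n l s : ℕ}

/-- Every `s × s` minor, with arbitrary (possibly repeated or unordered) rows and columns, lies in
the ideal of minors. -/
theorem det_submatrix_mem_minorIdeal (M : Matrix (Fin m) (Fin n) A) (i : Fin s → Fin m)
    (j : Fin s → Fin n) : (M.submatrix i j).det ∈ minorIdeal M s := by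
  by_cases hi : Function.Injective i
  · by_cases hj : Function.Injective j
    · have hi' : StrictMono (i ∘ Tuple.sort i) :=
        (Tuple.monotone_sort i).strictMono_of_injective (hi.comp (Equiv.injective _))
      have hj' : StrictMono (j ∘ Tuple.sort j) :=
        (Tuple.monotone_sort j).strictMono_of_injective (hj.comp (Equiv.injective _))
      have hmem : (M.submatrix (i ∘ Tuple.sort i) (j ∘ Tuple.sort j)).det ∈ minorIdeal M s :=
        Ideal.subset_span ⟨OrderEmbedding.ofStrictMono _ hi', OrderEmbedding.ofStrictMono _ hj', rfl⟩
      have hN : M.submatrix i j =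
          ((M.submatrix (i ∘ Tuple.sort i) (j ∘ Tuple.sort j)).submatrix
            (Tuple.sort i).symm id).submatrix id (Tuple.sort j).symm := by
        ext a b; simp
      rw [hN, Matrix.det_permute', Matrix.det_permute]
      exact Ideal.mul_mem_left _ _ (Ideal.mul_mem_left _ _ hmem)
    · obtain ⟨a, b, hab, hne⟩ : ∃ a b, j a = j b ∧ a ≠ b := by
        simpa [Function.Injective] using hj
      rw [Matrix.det_zero_of_column_eq hne fun c => by simp [hab]]
      exact Ideal.zero_mem _
  · obtain ⟨a, b, hab, hne⟩ : ∃ a b, i a = i b ∧ a ≠ b := by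
      simpa [Function.Injective] using hi
    rw [Matrix.det_zero_of_row_eq hne (by ext c; simp [hab])]
    exact Ideal.zero_mem _

theorem minorIdeal_transpose_le (M : Matrix (Fin m) (Fin n) A) (s : ℕ) :
    minorIdeal M.transpose s ≤ minorIdeal M s := by
  refine Ideal.span_le.2 ?_
  rintro _ ⟨i, j, rfl⟩
  rw [← Matrix.transpose_submatrix, Matrix.det_transpose]
  exact det_submatrix_mem_minorIdeal M j i

/-- Rows of `C * M` are combinations of rows of `M`. Expanding the determinant multilinearly yields
minors of `M` with arbitrary, possibly repeated rows. -/
theorem minorIdeal_mul_le_right (C : Matrix (Fin l) (Fin m) A) (M : Matrix (Fin m) (Fin n) A)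
    (s : ℕ) : minorIdeal (C * M) s ≤ minorIdeal M s := by
  refine Ideal.span_le.2 ?_
  rintro _ ⟨i, j, rfl⟩
  have hrow : (C * M).submatrix i j =
      Matrix.of fun a => ∑ b, C (i a) b • (fun c => M b (j c)) := by
    ext a c
    simp [Matrix.mul_apply]
  rw [hrow]
  change Matrix.detRowAlternating.toMultilinearMap
    (fun a => ∑ b, C (i a) b • (fun c => M b (j c))) ∈ minorIdeal M s
  rw [MultilinearMap.map_sum]
  refine Ideal.sum_mem _ fun g _ => ?_
  rw [MultilinearMap.map_smul_univ]
  exact Ideal.mul_mem_left _ _ (det_submatrix_mem_minorIdeal M g j)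

theorem minorIdeal_mul_le_left (M : Matrix (Fin l) (Fin m) A) (C : Matrix (Fin m) (Fin n) A)
    (s : ℕ) : minorIdeal (M * C) s ≤ minorIdeal M s := by
  have h := minorIdeal_transpose_le (M * C).transpose s
  rw [Matrix.transpose_transpose, Matrix.transpose_mul] at h
  exact h.trans ((minorIdeal_mul_le_right _ _ s).trans (minorIdeal_transpose_le M s))

theorem minorIdeal_map (g : A →+* B) (M : Matrix (Fin m) (Fin n) A) (s : ℕ) :
    minorIdeal (M.map g) s = (minorIdeal M s).map g := by
  rw [minorIdeal, minorIdeal, Ideal.map_span]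
  congr 1
  ext d
  constructor
  · rintro ⟨i, j, rfl⟩
    exact ⟨_, ⟨i, j, rfl⟩, by rw [RingHom.map_det]; rfl⟩
  · rintro ⟨_, ⟨i, j, rfl⟩, rfl⟩
    exact ⟨i, j, by rw [RingHom.map_det]; rfl⟩

end MinorIdeal

theorem PowerSeries.coeff_mem_of_mem_map_C {A : Type*} [CommRing A] {I : Ideal A}
    {q : PowerSeries A} (hq : q ∈ I.map (PowerSeries.C (R := A))) (k : ℕ) :
    PowerSeries.coeff k q ∈ I := by
  induction hq using Submodule.span_induction generalizing k with
  | mem x hx =>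
    obtain ⟨a, ha, rfl⟩ := hx
    rw [PowerSeries.coeff_C]
    split_ifs
    exacts [ha, I.zero_mem]
  | zero => simp
  | add x y _ _ hx hy => rw [map_add]; exact I.add_mem (hx k) (hy k)
  | smul a x _ hx =>
    rw [smul_eq_mul, PowerSeries.coeff_mul]
    exact I.sum_mem fun ij _ => I.mul_mem_left _ (hx ij.2)

namespace Derivation

/-- The extension of a derivation of `R` to power series, acting on coefficients. -/
noncomputable def powerSeries {K R : Type*} [CommRing K] [CommRing R] [Algebra K R]
    (D : Derivation K R R) : Derivation K (PowerSeries R) (PowerSeries R) :=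
  Derivation.mk'
    { toFun := fun q => PowerSeries.mk fun k => D (PowerSeries.coeff k q)
      map_add' := fun p q => by ext k; simp
      map_smul' := fun c q => by ext k; simp }
    fun p q => by
      ext k
      simp only [LinearMap.coe_mk, AddHom.coe_mk, smul_eq_mul, map_add, PowerSeries.coeff_mk,
        PowerSeries.coeff_mul, map_sum, Derivation.leibniz, Finset.sum_add_distrib]
      congr 1
      rw [← Finset.Nat.sum_antidiagonal_swap]
      rfl

@[simp]
theorem coeff_powerSeries {K R : Type*} [CommRing K] [CommRing R] [Algebra K R]
    (D : Derivation K R R) (q : PowerSeries R) (k : ℕ) :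
    PowerSeries.coeff k (D.powerSeries q) = D (PowerSeries.coeff k q) := by
  simp [powerSeries]

theorem map_mvPolynomial_aeval {K B ι : Type*} [CommRing K] [CommRing B] [Algebra K B] [Fintype ι]
    (D : Derivation K B B) (y : ι → B) (p : MvPolynomial ι K) :
    D (MvPolynomial.aeval y p) =
      ∑ i, MvPolynomial.aeval y (MvPolynomial.pderiv i p) * D (y i) := by
  classical
  induction p using MvPolynomial.induction_on with
  | C c => simp
  | add p q hp hq => simp [hp, hq, add_mul, Finset.sum_add_distrib]
  | mul_X p i hp =>
    simp only [map_mul, MvPolynomial.aeval_X, Derivation.leibniz, smul_eq_mul, hp, map_add,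
      MvPolynomial.pderiv_X, add_mul, Finset.sum_add_distrib, Finset.mul_sum]
    congr 1
    · rw [Finset.sum_eq_single i]
      · simp
      · intro b _ hb; simp [hb.symm]
      · simp
    · exact Finset.sum_congr rfl fun _ _ => by ring

/-- A localization is formally étale, so Ω[R⁄K] is the base change of Ω[P⁄K] and the linear map
representing `D` extends. -/
theorem exists_extension_of_isLocalization {K P R : Type*} [CommRing K] [CommRing P] [CommRing R]
    [Algebra K P] [Algebra K R] [Algebra P R] [IsScalarTower K P R] (M : Submonoid P)
    [IsLocalization M R] (D : Derivation K P P) :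
    ∃ D' : Derivation K R R, ∀ p, D' (algebraMap P R p) = algebraMap P R (D p) := by
  have := Algebra.FormallyEtale.of_isLocalization (Rₘ := R) M
  have hb := KaehlerDifferential.isBaseChange_of_formallyEtale K P R
  let g : Ω[P⁄K] →ₗ[P] R := (Algebra.linearMap P R).comp D.liftKaehlerDifferential
  refine ⟨(hb.lift g).compDer (KaehlerDifferential.D K R), fun p => ?_⟩
  have h := hb.lift_eq g (KaehlerDifferential.D K P p)
  rw [KaehlerDifferential.map_D] at h
  simpa [g] using h

end Derivation

namespace HigherDerivation

/-- The algebra homomorphism `a ↦ ∑ₖ δₖ(a) tᵏ` attached to a higher derivation. -/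
noncomputable def toPowerSeries {K A : Type*} [CommRing K] [CommRing A] [Algebra K A]
    (δ : HigherDerivation K A) : A →ₐ[K] PowerSeries A :=
  let φ : A →ₗ[K] PowerSeries A :=
    { toFun := fun a => PowerSeries.mk fun k => δ.map k a
      map_add' := fun a b => by ext k; simp
      map_smul' := fun c a => by ext k; simp }
  have hmul : ∀ a b, φ (a * b) = φ a * φ b := fun a b => by
    ext k
    simp [φ, PowerSeries.coeff_mul, δ.map_mul]
  AlgHom.ofLinearMap φ
    (by
      -- `φ 1` is idempotent with constant term 1, hence a unit, hence 1.
      have hu : IsUnit (φ 1) := by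
        rw [PowerSeries.isUnit_iff_constantCoeff, ← PowerSeries.coeff_zero_eq_constantCoeff_apply]
        simp [φ, δ.map_zero]
      refine hu.mul_left_cancel ?_
      rw [← hmul, mul_one, mul_one])
    hmul

@[simp]
theorem coeff_toPowerSeries {K A : Type*} [CommRing K] [CommRing A] [Algebra K A]
    (δ : HigherDerivation K A) (a : A) (k : ℕ) :
    PowerSeries.coeff k (δ.toPowerSeries a) = δ.map k a := by
  simp [toPowerSeries]

end HigherDerivation

/-- Let `A` be the quotient of `R` by the ideal generated by the values `fᵢ(x)`, where `R` carries
derivations dual to `x`. Then higher derivations of `A` preserve the ideals of minors of the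
Jacobi matrix. -/
theorem HigherDerivation.map_mem_minorIdeal {K R A : Type*} [CommRing K] [CommRing R] [CommRing A]
    [Algebra K R] [Algebra K A] {m n : ℕ} (π : R →ₐ[K] A) (hπ : Function.Surjective π)
    (f : Fin m → MvPolynomial (Fin n) K) (x : Fin n → R)
    (hker : RingHom.ker π = Ideal.span (Set.range fun l => MvPolynomial.aeval x (f l)))
    (D : Fin n → Derivation K R R) (hD : ∀ s j, D j (x s) = if s = j then 1 else 0)
    (J : Matrix (Fin m) (Fin n) A)
    (hJ : ∀ i j, J i j = π (MvPolynomial.aeval x (MvPolynomial.pderiv j (f i))))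
    (δ : HigherDerivation K A) (r k : ℕ) {a : A} (ha : a ∈ minorIdeal J r) :
    δ.map k a ∈ minorIdeal J r := by
  classical
  let φ := δ.toPowerSeries
  -- The constant term must be `x s` itself, not just some lift of its image: this makes `M` the
  -- identity modulo t.
  let Y : Fin n → PowerSeries R := fun s => PowerSeries.mk fun k =>
    if k = 0 then x s else Function.surjInv hπ (δ.map k (π (x s)))
  let Φ : PowerSeries R →ₐ[K] PowerSeries A := PowerSeries.mapAlgHom π
  have hΦ : ∀ (q : PowerSeries R) (k : ℕ),
      PowerSeries.coeff k (Φ q) = π (PowerSeries.coeff k q) := fun q k => by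
    simp [Φ, PowerSeries.mapAlgHom_apply]
  have hΦC : ∀ c : R, Φ (PowerSeries.C c) = PowerSeries.C (π c) := fun c => by
    simp [Φ, PowerSeries.mapAlgHom_apply]
  have hΦY : ∀ s, Φ (Y s) = φ (π (x s)) := by
    intro s
    ext k
    rw [hΦ, PowerSeries.coeff_mk, δ.coeff_toPowerSeries]
    split_ifs with hk
    · simp [hk, δ.map_zero]
    · exact Function.surjInv_eq hπ _
  have haeval : ∀ p : MvPolynomial (Fin n) K,
      Φ (MvPolynomial.aeval Y p) = φ (π (MvPolynomial.aeval x p)) := by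
    have : Φ.comp (MvPolynomial.aeval Y) = (φ.comp π).comp (MvPolynomial.aeval x) :=
      MvPolynomial.algHom_ext fun s => by simpa using hΦY s
    exact fun p => DFunLike.congr_fun this p
  have hF : ∀ l, π (MvPolynomial.aeval x (f l)) = 0 := fun l => by
    rw [← RingHom.mem_ker, hker]
    exact Ideal.subset_span ⟨l, rfl⟩
  have hcoeff : ∀ i k, ∃ c : Fin m → R,
      ∑ l, c l * MvPolynomial.aeval x (f l) =
        PowerSeries.coeff k (MvPolynomial.aeval Y (f i)) := by
    intro i k
    rw [← Ideal.mem_span_range_iff_exists_fun, ← hker, RingHom.mem_ker, ← hΦ, haeval, hF, _root_.map_zero,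
      _root_.map_zero]
  choose c hc using hcoeff
  let N : Matrix (Fin m) (Fin m) (PowerSeries R) := fun i l => PowerSeries.mk fun k => c i k l
  have hN : ∀ i, MvPolynomial.aeval Y (f i) =
      ∑ l, N i l * PowerSeries.C (MvPolynomial.aeval x (f l)) := by
    intro i
    ext k
    simp only [N, ← hc, map_sum, PowerSeries.coeff_mul_C, PowerSeries.coeff_mk]
  have hDC : ∀ j l, (D j).powerSeries (PowerSeries.C (MvPolynomial.aeval x (f l))) =
      PowerSeries.C (MvPolynomial.aeval x (MvPolynomial.pderiv j (f l))) := by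
    intro j l
    ext k
    rw [Derivation.coeff_powerSeries, PowerSeries.coeff_C, PowerSeries.coeff_C]
    split_ifs
    · simp [Derivation.map_mvPolynomial_aeval, hD]
    · simp
  let M : Matrix (Fin n) (Fin n) (PowerSeries A) := fun s j => Φ ((D j).powerSeries (Y s))
  have hM : IsUnit M.det := by
    rw [PowerSeries.isUnit_iff_constantCoeff, RingHom.map_det]
    convert isUnit_one
    convert Matrix.det_one (R := A) (n := Fin n)
    ext s j
    rw [RingHom.mapMatrix_apply, Matrix.map_apply, ← PowerSeries.coeff_zero_eq_constantCoeff_apply]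
    simp only [M, hΦ, Derivation.coeff_powerSeries, Y, PowerSeries.coeff_mk, if_true, hD,
      Matrix.one_apply]
    split_ifs <;> simp
  -- Chain rule on the left of `hN`, Leibniz on the right; the terms containing derivatives of `N`
  -- carry a factor fₗ(x), which `Φ` kills.
  have hmul : J.map φ * M = N.map Φ * J.map (PowerSeries.C (R := A)) := by
    ext1 i j
    have h := congrArg (fun q => Φ ((D j).powerSeries q)) (hN i)
    simp only [Derivation.map_mvPolynomial_aeval, map_sum, _root_.map_mul, Derivation.leibniz,
      map_add, smul_eq_mul, hDC, hΦC, hF, _root_.map_zero, zero_mul, add_zero, haeval] at h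
    simpa only [Matrix.mul_apply, Matrix.map_apply, hJ] using h
  have hJφ : J.map φ = N.map Φ * J.map (PowerSeries.C (R := A)) * M⁻¹ := by
    rw [← hmul, Matrix.mul_nonsing_inv_cancel_right _ _ hM]
  have hle : minorIdeal (J.map φ) r ≤ (minorIdeal J r).map (PowerSeries.C (R := A)) := by
    rw [hJφ, ← minorIdeal_map]
    exact (minorIdeal_mul_le_left _ _ r).trans (minorIdeal_mul_le_right _ _ r)
  have hφa : φ a ∈ minorIdeal (J.map φ) r := by
    have := minorIdeal_map (φ : A →+* PowerSeries A) J r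
    exact this ▸ Ideal.mem_map_of_mem (φ : A →+* PowerSeries A) ha
  rw [← δ.coeff_toPowerSeries]
  exact PowerSeries.coeff_mem_of_mem_map_C (hle hφa) k

theorem theorem2p15 {K : Type*} [Field K] [PerfectField K] (p : ℕ) [Fact p.Prime] [CharP K p]
    {m n : ℕ} (f : Fin m → MvPolynomial (Fin n) K)
    (hprime : (Ideal.span (Set.range f)).IsPrime)
    (hnotmax : ¬ (Ideal.span (Set.range f)).IsMaximal)
    (S : Submonoid (MvPolynomial (Fin n) K ⧸ Ideal.span (Set.range f)))
    (A : Type*) [CommRing A] [IsDomain A]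
    [Algebra (MvPolynomial (Fin n) K ⧸ Ideal.span (Set.range f)) A] [IsLocalization S A]
    [Algebra K A] [IsScalarTower K (MvPolynomial (Fin n) K ⧸ Ideal.span (Set.range f)) A]
    (δ : HigherDerivation K A) (k : ℕ) (a : A) (ha : a ∈ jacobianIdeal f A) :
    δ.map k a ∈ jacobianIdeal f A := by
  classical
  let I := Ideal.span (Set.range f)
  let g : MvPolynomial (Fin n) K →+* MvPolynomial (Fin n) K ⧸ I := Ideal.Quotient.mk I
  have hg : Function.Surjective g := Ideal.Quotient.mk_surjective
  -- Localizing before taking the quotient presents `A` as R/(f) with R = T⁻¹P, to which the partial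
  -- derivatives extend.
  let T : Submonoid (MvPolynomial (Fin n) K) := S.comap g
  have hT : T.map g = S := Submonoid.map_comap_eq_of_surjective hg S
  let R := Localization T
  let ρ : R →+* A := IsLocalization.map A g (hT.symm ▸ T.le_comap_map)
  have hρ : ∀ q, ρ (algebraMap _ R q) = algebraMap _ A (g q) := IsLocalization.map_eq _
  let π : R →ₐ[K] A :=
    { ρ with
      commutes' := fun c => by
        change ρ (algebraMap K R c) = _
        rw [IsScalarTower.algebraMap_apply K (MvPolynomial (Fin n) K) R, hρ,
          IsScalarTower.algebraMap_apply K (MvPolynomial (Fin n) K ⧸ I) A]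
        rfl }
  have hπ : ∀ q, π (algebraMap _ R q) = algebraMap _ A (g q) := hρ
  have hsurj : Function.Surjective π := by
    intro b
    obtain ⟨b, ⟨s, hs⟩, rfl⟩ := IsLocalization.exists_mk'_eq S b
    obtain ⟨b, rfl⟩ := hg b
    obtain ⟨s, rfl⟩ := hg s
    exact ⟨IsLocalization.mk' R b ⟨s, hs⟩, IsLocalization.map_mk' (hT.symm ▸ T.le_comap_map) _ _⟩
  let x : Fin n → R := fun s => algebraMap (MvPolynomial (Fin n) K) R (MvPolynomial.X s)
  have hx : ∀ q : MvPolynomial (Fin n) K, MvPolynomial.aeval x q = algebraMap _ R q := by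
    have : MvPolynomial.aeval x = IsScalarTower.toAlgHom K (MvPolynomial (Fin n) K) R :=
      MvPolynomial.algHom_ext fun s => by simp [x]
    exact fun q => DFunLike.congr_fun this q
  have hker : RingHom.ker π = Ideal.span (Set.range fun l => MvPolynomial.aeval x (f l)) := by
    have h : RingHom.ker ρ = (RingHom.ker g).map (algebraMap _ R) :=
      IsLocalization.ker_map (S := R) A g hT
    rw [Ideal.mk_ker, Ideal.map_span, ← Set.range_comp] at h
    simp only [hx]
    exact h
  choose D hD using fun j : Fin n =>
    Derivation.exists_extension_of_isLocalization (R := R) T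
      (MvPolynomial.pderiv (R := K) j)
  refine δ.map_mem_minorIdeal π hsurj f x hker D (fun s j => ?_) _ (fun i j => ?_) _ k ha
  · rw [hD, MvPolynomial.pderiv_X, Pi.single_apply]
    split_ifs <;> simp_all
  · rw [hx, hπ]
    rfl
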